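/- Let $G$ be a complex semisimple Lie group whose Lie algebra $\mathfrak g=\bigoplus_{m\in\mathbb Z}\mathfrak g_m$ is $\mathbb Z$-graded. Let $\tilde N_\pm,\tilde B_\pm,\tilde H$ be the connected subgroups of $G$ corresponding to the subalgebras $\tilde{\mathfrak n}_\pm=\bigoplus_{\pm m>0}\mathfrak g_m$, $\tilde{\mathfrak b}_\pm=\bigoplus_{\pm m\ge 0}\mathfrak g_m$, $\mathfrak g_0$; put $F_\pm=G/\tilde B_\mp$, with projections $\pi_\pm:G\to F_\pm$. Fix nonzero $x_\pm\in\mathfrak g_{\pm1}$ and let $\mathcal O_\pm=\mathrm{Ad}(\tilde H)x_\pm$. Let $\sigma$ be an involutive antilinear automorphism of $\mathfrak g$ with $\sigma(\mathfrak g_m)=\mathfrak g_{-m}$ for all $m$, which extends to an antiholomorphic automorphism $\Sigma$ of $G$, and put $g^\star=\Sigma(g^{-1})$. Let $\theta$ be the (holomorphic, $\mathfrak g$-valued) Maurer–Cartan form of $G$. Let $M$ be a complex manifold of complex dimension one and let $\varphi:M\to G$ be an admissible mapping, that is, a smooth mapping such that, for every local coordinate $z$ on $M$, writing $\varphi^*\theta=\omega_-dz+\omega_+d\bar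 z$, the coefficients $\omega_-$ and $\omega_+$ take values in $(\mathfrak g_{-1}\oplus\mathfrak g_0)\cap(\mathcal O_-+\tilde{\mathfrak b}_+)$ and $(\mathfrak g_0\oplus\mathfrak g_1)\cap(\mathcal O_++\tilde{\mathfrak b}_-)$ respectively. Put $\varphi_\pm=\pi_\pm\circ\varphi$. Make the following choices: elements $a_\pm\in G$; an open set $W\subset M$ with a local coordinate $z$ defined on it, such that $\varphi_\pm(W)\subset\pi_\pm(a_\pm\tilde N_\pm)$; and, with $s_\pm$ the local section of $G\to F_\pm$ over $\pi_\pm(a_\pm\tilde N_\pm)$ with image $a_\pm\tilde N_\pm$ and $\mu_\pm=s_\pm\circ\varphi_\pm$ on $W$, mappings $\gamma_\pm:W\to\tilde H$, with $\gamma_-$ holomorphic and $\gamma_+$ antiholomorphic, such that the coefficient $\lambda_-$ of $dz$ in $\mu_-^*\theta$ and the coefficient $\lambda_+$ of $d\bar z$ in $\mu_+^*\theta$ are $\lambda_\pm=\sqrt{-1}\,\mathrm{Ad}(\gamma_\pm)x_\pm$. Let $$\varphi=\mu_+\nu_-\eta_-,\qquad \varphi=\mu_-\nu_+\eta_+$$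 on $W$, with $\nu_\pm$ taking values in $\tilde N_\pm$ and $\eta_\pm$ in $\tilde H$. The Toda mapping for these choices is $\gamma=\gamma_+^{-1}\,\eta_-\eta_+^{-1}\,\gamma_-:W\to\tilde H$. **Theorem.** Let $\rho:G\to GL(V)$ be any $\Sigma$-unitary representation, that is, a representation in a complex vector space $V$ equipped with a hermitian scalar product such that $\langle\rho(g)u,v\rangle=\langle u,\rho(g^\star)v\rangle$ for all $g\in G$ and $u,v\in V$ (positive definiteness is not needed). Let $V_+\subset V$ be the subspace of the $\tilde N_+$-invariant vectors. For $u,v\in V$ and a mapping $f$ to $G$ write $\langle u,f v\rangle(p)=\langle u,\rho(f(p))v\rangle$. Then, for all $u,v\in V_+$, on $W$ $$\langle u,\gamma v\rangle=\langle u,(\mu_+\gamma_+)^{-1}(\mu_-\gamma_-)v\rangle .$$ These matrix elements are therefore determined by the mappings $\varphi_\pm$ alone: if $\varphi'$ is another admissible mapping with $\pi_\pm\circ\varphi'=\pi_\pm\circ\varphi$ on $W$, then the same choices $a_\pm,W,z,\gamma_\pm$ are suitable for $\varphi'$, and the Toda mapping $\gamma'$ of $\varphi'$ for these choices satisfies $\langle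 u,\gamma' v\rangle=\langle u,\gamma v\rangle$ on $W$ for all $u,v\in V_+$. -/

import Mathlib

open scoped Manifold ContDiff

noncomputable section

namespace Toda

section Holomorphic

/-- `f` is holomorphic on the (open) set `s`. -/
def HolomorphicOn (E F : Type*) [NormedAddCommGroup E] [NormedSpace ℂ E]
    [NormedAddCommGroup F] [NormedSpace ℂ F]
    {X : Type*} [TopologicalSpace X] [ChartedSpace E X]
    {Y : Type*} [TopologicalSpace Y] [ChartedSpace F Y] (f : X → Y) (s : Set X) : Prop :=
  ∀ p ∈ s, MDifferentiableAt 𝓘(ℂ, E) 𝓘(ℂ, F) f p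

/-- The differential of `f` at `p`, both manifolds being regarded as real manifolds. The tangent
spaces are the model spaces `E` and `F` (through the preferred charts at `p` and `f p`). -/
def realDeriv (E F : Type*) [NormedAddCommGroup E] [NormedSpace ℂ E]
    [NormedAddCommGroup F] [NormedSpace ℂ F]
    {X : Type*} [TopologicalSpace X] [ChartedSpace E X]
    {Y : Type*} [TopologicalSpace Y] [ChartedSpace F Y] (f : X → Y) (p : X) : E →L[ℝ] F :=
  mfderiv 𝓘(ℝ, E) 𝓘(ℝ, F) f p

/-- `f` is antiholomorphic on the (open) set `s`: it is real differentiable there and its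
differential anticommutes with the complex structures. -/
def AntiholomorphicOn (E F : Type*) [NormedAddCommGroup E] [NormedSpace ℂ E]
    [NormedAddCommGroup F] [NormedSpace ℂ F]
    {X : Type*} [TopologicalSpace X] [ChartedSpace E X]
    {Y : Type*} [TopologicalSpace Y] [ChartedSpace F Y] (f : X → Y) (s : Set X) : Prop :=
  ∀ p ∈ s, MDifferentiableAt 𝓘(ℝ, E) 𝓘(ℝ, F) f p ∧
    ∀ x : E, realDeriv E F f p (Complex.I • x) = -(Complex.I • realDeriv E F f p x)

end Holomorphic

section Group

variable {E : Type*} [NormedAddCommGroup E] [NormedSpace ℂ E]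
  {G : Type*} [TopologicalSpace G] [ChartedSpace E G] [Group G]

/-- The adjoint action of `g` on the Lie algebra: the differential at `1` of `h ↦ g h g⁻¹`. -/
def Ad (g : G) (x : GroupLieAlgebra 𝓘(ℂ, E) G) : GroupLieAlgebra 𝓘(ℂ, E) G :=
  (mfderiv 𝓘(ℂ, E) 𝓘(ℂ, E) (fun h : G => g * h * g⁻¹) 1 : E →L[ℂ] E) x

/-- The velocity at time `0` of a curve `c` with `c 0 = 1`, as an element of the Lie algebra. -/
def initialVelocity (c : ℝ → G) : GroupLieAlgebra 𝓘(ℂ, E) G :=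
  (mfderiv 𝓘(ℝ, ℝ) 𝓘(ℝ, E) c 0 : ℝ →L[ℝ] E) 1

/-- `c` is a (smooth, real) one-parameter subgroup. -/
def IsOneParameterSubgroup (E : Type*) [NormedAddCommGroup E] [NormedSpace ℂ E]
    {G : Type*} [TopologicalSpace G] [ChartedSpace E G] [Group G] (c : ℝ → G) : Prop :=
  (∀ s t : ℝ, c (s + t) = c s * c t) ∧ ContMDiff 𝓘(ℝ, ℝ) 𝓘(ℝ, E) ∞ c

/-- The connected Lie subgroup of `G` corresponding to a Lie subalgebra `k`: the subgroup
generated by `exp k`, that is, by the values at time `1` of the one-parameter subgroups with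
initial velocity in `k`. -/
def connectedSubgroup (k : Submodule ℂ (GroupLieAlgebra 𝓘(ℂ, E) G)) : Subgroup G :=
  Subgroup.closure
    {g | ∃ c : ℝ → G, IsOneParameterSubgroup E c ∧ initialVelocity c ∈ k ∧ g = c 1}

/-- A `ℤ`-gradation of the Lie algebra of `G`. -/
structure IsGradation [LieGroup 𝓘(ℂ, E) ω G]
    (gr : ℤ → Submodule ℂ (GroupLieAlgebra 𝓘(ℂ, E) G)) : Prop where
  isInternal : DirectSum.IsInternal gr
  lie_mem : ∀ (m k : ℤ) (x y : GroupLieAlgebra 𝓘(ℂ, E) G),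
    x ∈ gr m → y ∈ gr k → ⁅x, y⁆ ∈ gr (m + k)

variable (gr : ℤ → Submodule ℂ (GroupLieAlgebra 𝓘(ℂ, E) G))

/-- The sum of the components of negative degree. -/
def nMinusAlg : Submodule ℂ (GroupLieAlgebra 𝓘(ℂ, E) G) := ⨆ m : ℤ, ⨆ _ : m < 0, gr m

/-- The sum of the components of positive degree. -/
def nPlusAlg : Submodule ℂ (GroupLieAlgebra 𝓘(ℂ, E) G) := ⨆ m : ℤ, ⨆ _ : 0 < m, gr m

/-- The sum of the components of nonpositive degree. -/
def bMinusAlg : Submodule ℂ (GroupLieAlgebra 𝓘(ℂ, E) G) := ⨆ m : ℤ, ⨆ _ : m ≤ 0, gr m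

/-- The sum of the components of nonnegative degree. -/
def bPlusAlg : Submodule ℂ (GroupLieAlgebra 𝓘(ℂ, E) G) := ⨆ m : ℤ, ⨆ _ : 0 ≤ m, gr m

/-- The connected subgroup `Ñ₋` of `G`. -/
def NMinus : Subgroup G := connectedSubgroup (nMinusAlg gr)

/-- The connected subgroup `Ñ₊` of `G`. -/
def NPlus : Subgroup G := connectedSubgroup (nPlusAlg gr)

/-- The connected subgroup `B̃₋` of `G`. -/
def BMinus : Subgroup G := connectedSubgroup (bMinusAlg gr)

/-- The connected subgroup `B̃₊` of `G`. -/
def BPlus : Subgroup G := connectedSubgroup (bPlusAlg gr)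

/-- The connected subgroup `H̃` of `G`. -/
def HZero : Subgroup G := connectedSubgroup (gr 0)

/-- The flag manifold `F₊ = G / B̃₋`. -/
abbrev FPlus : Type _ := G ⧸ BMinus gr

/-- The flag manifold `F₋ = G / B̃₊`. -/
abbrev FMinus : Type _ := G ⧸ BPlus gr

/-- The canonical projection `π₊ : G → F₊`. -/
def piPlus (g : G) : FPlus gr := (g : G ⧸ BMinus gr)

/-- The canonical projection `π₋ : G → F₋`. -/
def piMinus (g : G) : FMinus gr := (g : G ⧸ BPlus gr)

/-- The image in `G / B` of the left translate `a N`; it is the domain of a local section. -/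
def sectionDomain {G : Type*} [Group G] (N B : Subgroup G) (a : G) : Set (G ⧸ B) :=
  {p | ∃ g : G, a⁻¹ * g ∈ N ∧ (g : G ⧸ B) = p}

open Classical in
/-- The local section of `G → G / B` with image `a N`: the point `p` of its domain is sent to the
element of `a N` lying over `p` (and a point outside the domain to the junk value `1`). For
`N, B = Ñ₊, B̃₋` and for `N, B = Ñ₋, B̃₊` that element is unique. -/
def localSection {G : Type*} [Group G] (N B : Subgroup G) (a : G) (p : G ⧸ B) : G :=
  if h : p ∈ sectionDomain N B a then Classical.choose h else 1

theorem localSection_spec {G : Type*} [Group G] (N B : Subgroup G) (a : G) (p : G ⧸ B)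
    (h : p ∈ sectionDomain N B a) :
    a⁻¹ * localSection N B a p ∈ N ∧ QuotientGroup.mk (s := B) (localSection N B a p) = p := by
  unfold localSection
  rw [dif_pos h]
  exact Classical.choose_spec h

/-- The orbit of `x` under the adjoint action of `H̃`. -/
def orbit (x : GroupLieAlgebra 𝓘(ℂ, E) G) : Set (GroupLieAlgebra 𝓘(ℂ, E) G) :=
  {y | ∃ h ∈ HZero gr, y = Ad h x}

end Group

section Forms

variable {E : Type*} [NormedAddCommGroup E] [NormedSpace ℂ E]
  {G : Type*} [TopologicalSpace G] [ChartedSpace E G] [Group G]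
  {M : Type*} [TopologicalSpace M] [ChartedSpace ℂ M]

/-- The Maurer-Cartan form of `G` at `g`: the differential of left translation by `g⁻¹`. -/
def maurerCartan (g : G) (x : E) : GroupLieAlgebra 𝓘(ℂ, E) G :=
  (mfderiv 𝓘(ℂ, E) 𝓘(ℂ, E) (fun h : G => g⁻¹ * h) g : E →L[ℂ] E) x

/-- The pullback `ω = f^* θ` of the Maurer-Cartan form `θ` by `f : M → G`, evaluated at the real
tangent vector `x` at `p`. -/
def pullbackForm (f : M → G) (p : M) (x : ℂ) : GroupLieAlgebra 𝓘(ℂ, E) G :=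
  maurerCartan (f p) (realDeriv ℂ E f p x)

/-- For a local coordinate `z` and `p` in its domain, the real tangent vector at `p` whose
coordinate expression is `c`; so `c = 1` gives `∂/∂x` and `c = i` gives `∂/∂y`, `z = x + i y`. -/
def coordVector (z : OpenPartialHomeomorph M ℂ) (p : M) (c : ℂ) : ℂ :=
  realDeriv ℂ ℂ z.symm (z p) c

/-- The coefficient of `dz` in `f^* θ`, i.e. its value at `∂_z = (∂_x - i ∂_y) / 2`. -/
def dzComponent (z : OpenPartialHomeomorph M ℂ) (f : M → G) (p : M) :
    GroupLieAlgebra 𝓘(ℂ, E) G :=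
  (1 / 2 : ℂ) • (pullbackForm f p (coordVector z p 1)
    - Complex.I • pullbackForm f p (coordVector z p Complex.I))

/-- The coefficient of `dz̄` in `f^* θ`, i.e. its value at `∂_z̄ = (∂_x + i ∂_y) / 2`. -/
def dzbarComponent (z : OpenPartialHomeomorph M ℂ) (f : M → G) (p : M) :
    GroupLieAlgebra 𝓘(ℂ, E) G :=
  (1 / 2 : ℂ) • (pullbackForm f p (coordVector z p 1)
    + Complex.I • pullbackForm f p (coordVector z p Complex.I))

/-- Admissible mappings `φ : M → G`. The conditions `dz_mem` and `dzbar_mem` are the grading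
condition on `ω = φ^* θ`. The kernel of the differential of `π₋ : G → G / B̃₊` at `g` is the left
translate by `g` of `b̃₊`, so `dz_orbit` says that `φ₋_* ∂_z` belongs to the image under `π₋_*` of
the left translate to `g = φ p` of the orbit of `xMinus` (another `g` over `φ₋ p` gives the same
image). In the same way `dzbar_orbit` says that `φ₊_* ∂_z̄` belongs to the image under `π₊_*` of
the left translate of the orbit of `xPlus`. -/
structure IsAdmissible (gr : ℤ → Submodule ℂ (GroupLieAlgebra 𝓘(ℂ, E) G))
    (xPlus xMinus : GroupLieAlgebra 𝓘(ℂ, E) G) (φ : M → G) : Prop where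
  smooth : ContMDiff 𝓘(ℝ, ℂ) 𝓘(ℝ, E) ∞ φ
  dz_mem : ∀ z ∈ IsManifold.maximalAtlas 𝓘(ℂ, ℂ) ω M, ∀ p ∈ z.source,
    dzComponent z φ p ∈ gr (-1) ⊔ gr 0
  dzbar_mem : ∀ z ∈ IsManifold.maximalAtlas 𝓘(ℂ, ℂ) ω M, ∀ p ∈ z.source,
    dzbarComponent z φ p ∈ gr 0 ⊔ gr 1
  dz_orbit : ∀ z ∈ IsManifold.maximalAtlas 𝓘(ℂ, ℂ) ω M, ∀ p ∈ z.source,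
    ∃ y ∈ orbit gr xMinus, dzComponent z φ p - y ∈ bPlusAlg gr
  dzbar_orbit : ∀ z ∈ IsManifold.maximalAtlas 𝓘(ℂ, ℂ) ω M, ∀ p ∈ z.source,
    ∃ y ∈ orbit gr xPlus, dzbarComponent z φ p - y ∈ bMinusAlg gr

/-- The choices in the construction of a local Toda mapping: an open set `W` with a local
coordinate `z`, the elements `aPlus`, `aMinus` that fix the local sections of `G → F₊` and of
`G → F₋` with images `aPlus Ñ₊` and `aMinus Ñ₋`, and the lifts `γ₊`, `γ₋`. -/
structure LocalChoice (G M : Type*) [TopologicalSpace M] where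
  W : Set M
  z : OpenPartialHomeomorph M ℂ
  aPlus : G
  aMinus : G
  gammaPlus : M → G
  gammaMinus : M → G

variable (gr : ℤ → Submodule ℂ (GroupLieAlgebra 𝓘(ℂ, E) G))

/-- The mapping `μ₊ = s₊ ∘ φ₊`, where `s₊` is the local section of `G → F₊` with image
`a Ñ₊`. -/
def muPlus (a : G) (φPlus : M → FPlus gr) (p : M) : G :=
  localSection (NPlus gr) (BMinus gr) a (φPlus p)

/-- The mapping `μ₋ = s₋ ∘ φ₋`, where `s₋` is the local section of `G → F₋` with image
`a Ñ₋`. -/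
def muMinus (a : G) (φMinus : M → FMinus gr) (p : M) : G :=
  localSection (NMinus gr) (BPlus gr) a (φMinus p)

/-- The choices `D` are suitable for the mappings `φ₊`, `φ₋`: on `W` the mappings `μ±` are
defined, and `γ±` are mappings to `H̃`, antiholomorphic resp. holomorphic, that lift
`λ±`, where `λ₋` is the `dz`-component of `μ₋^* θ` and `λ₊` the `dz̄`-component of `μ₊^* θ`. -/
structure LocalChoice.IsSuitable (xPlus xMinus : GroupLieAlgebra 𝓘(ℂ, E) G)
    (φPlus : M → FPlus gr) (φMinus : M → FMinus gr) (D : LocalChoice G M) : Prop where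
  isOpen : IsOpen D.W
  chart : D.z ∈ IsManifold.maximalAtlas 𝓘(ℂ, ℂ) ω M
  subset_source : D.W ⊆ D.z.source
  plus_mem : ∀ p ∈ D.W, φPlus p ∈ sectionDomain (NPlus gr) (BMinus gr) D.aPlus
  minus_mem : ∀ p ∈ D.W, φMinus p ∈ sectionDomain (NMinus gr) (BPlus gr) D.aMinus
  gammaPlus_mem : ∀ p ∈ D.W, D.gammaPlus p ∈ HZero gr
  gammaMinus_mem : ∀ p ∈ D.W, D.gammaMinus p ∈ HZero gr
  gammaPlus_anti : AntiholomorphicOn ℂ E D.gammaPlus D.W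
  gammaMinus_holo : HolomorphicOn ℂ E D.gammaMinus D.W
  lift_plus : ∀ p ∈ D.W,
    dzbarComponent D.z (muPlus gr D.aPlus φPlus) p = Complex.I • Ad (D.gammaPlus p) xPlus
  lift_minus : ∀ p ∈ D.W,
    dzComponent D.z (muMinus gr D.aMinus φMinus) p = Complex.I • Ad (D.gammaMinus p) xMinus

/-- `γ` is the Toda mapping of `φ` on `W` for the choices `D`: `γ = γ₊⁻¹ η γ₋` with
`η = η₋ η₊⁻¹`, where `φ = μ₊ ν₋ η₋` and `φ = μ₋ ν₊ η₊` are the modified Gauss decompositions,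
`ν±` with values in `Ñ±` and `η±` with values in `H̃`. -/
def IsTodaMapping (φ : M → G) (D : LocalChoice G M) (γ : M → G) : Prop :=
  ∃ νMinus ηMinus νPlus ηPlus : M → G, ∀ p ∈ D.W,
    νMinus p ∈ NMinus gr ∧ ηMinus p ∈ HZero gr ∧ νPlus p ∈ NPlus gr ∧ ηPlus p ∈ HZero gr ∧
    φ p = muPlus gr D.aPlus (piPlus gr ∘ φ) p * νMinus p * ηMinus p ∧
    φ p = muMinus gr D.aMinus (piMinus gr ∘ φ) p * νPlus p * ηPlus p ∧
    γ p = (D.gammaPlus p)⁻¹ * (ηMinus p * (ηPlus p)⁻¹) * D.gammaMinus p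

end Forms

section Conjugation

variable {E : Type*} [NormedAddCommGroup E] [NormedSpace ℂ E]
  {G : Type*} [TopologicalSpace G] [ChartedSpace E G] [Group G]

/-- `σ` is an involutive antilinear automorphism of the Lie algebra with `σ(g_m) = g_{-m}`. -/
structure IsGradedConjugation [LieGroup 𝓘(ℂ, E) ω G]
    (gr : ℤ → Submodule ℂ (GroupLieAlgebra 𝓘(ℂ, E) G))
    (σ : GroupLieAlgebra 𝓘(ℂ, E) G →ₛₗ[starRingEnd ℂ] GroupLieAlgebra 𝓘(ℂ, E) G) : Prop where
  involutive : Function.Involutive σ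
  map_lie : ∀ x y : GroupLieAlgebra 𝓘(ℂ, E) G, σ ⁅x, y⁆ = ⁅σ x, σ y⁆
  image_gr : ∀ m : ℤ, σ '' (gr m : Set (GroupLieAlgebra 𝓘(ℂ, E) G)) = gr (-m)

/-- `S` is an antiholomorphic automorphism of the group `G` that extends `σ`, i.e. whose
differential at `1` is `σ`. -/
structure IsAntiholomorphicExtension
    (σ : GroupLieAlgebra 𝓘(ℂ, E) G →ₛₗ[starRingEnd ℂ] GroupLieAlgebra 𝓘(ℂ, E) G)
    (S : G ≃* G) : Prop where
  antiholomorphic : AntiholomorphicOn E E S Set.univ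
  deriv_one : ∀ x : GroupLieAlgebra 𝓘(ℂ, E) G, realDeriv E E S (1 : G) x = σ x

/-- The `Σ`-hermitian conjugation `g ↦ g^⋆ = Σ(g⁻¹)` of `G`. -/
def hermConj {G : Type*} [Group G] (S : G ≃* G) (g : G) : G := S g⁻¹

/-- The representation `ρ` is `Σ`-unitary with respect to the hermitian form `B` (antilinear in
the first argument): the adjoint of `ρ g` is `ρ (g^⋆)`. Scalar products are the positive definite
`B`; definiteness is not demanded. -/
structure IsSigmaUnitary {G : Type*} [Group G] (S : G ≃* G)
    {V : Type*} [AddCommGroup V] [Module ℂ V]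
    (B : V →ₗ⋆[ℂ] V →ₗ[ℂ] ℂ) (ρ : Representation ℂ G V) : Prop where
  hermitian : ∀ u v : V, starRingEnd ℂ (B u v) = B v u
  adjoint : ∀ (g : G) (u v : V), B (ρ g u) v = B u (ρ (hermConj S g) v)

/-- The subspace `V₊` of the vectors that are invariant under `Ñ₊`. -/
def VPlus (gr : ℤ → Submodule ℂ (GroupLieAlgebra 𝓘(ℂ, E) G))
    {V : Type*} [AddCommGroup V] [Module ℂ V] (ρ : Representation ℂ G V) : Submodule ℂ V where
  carrier := {v | ∀ g ∈ NPlus gr, ρ g v = v}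
  add_mem' := by
    intro a b ha hb g hg
    rw [map_add, ha g hg, hb g hg]
  zero_mem' := by
    intro g _
    rw [map_zero]
  smul_mem' := by
    intro c a ha g hg
    rw [map_smul, ha g hg]

/-- The function `⟨u, f v⟩` on `M`, for a mapping `f : M → G`. -/
def matrixElement {G : Type*} [Group G] {V : Type*} [AddCommGroup V] [Module ℂ V]
    {M : Type*} (B : V →ₗ⋆[ℂ] V →ₗ[ℂ] ℂ) (ρ : Representation ℂ G V)
    (u : V) (f : M → G) (v : V) (p : M) : ℂ :=
  B u (ρ (f p) v)

end Conjugation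

end Toda

end

noncomputable section

namespace Toda

open Set Filter Topology VectorField

/-! Comparing the two decompositions of `φ` gives `μ₊⁻¹μ₋ = ν₋ (η₋η₊⁻¹) ν₊⁻¹`, hence `(μ₊γ₊)⁻¹(μ₋γ₋)
= (γ₊⁻¹ν₋γ₊) γ (γ₋⁻¹ν₊⁻¹γ₋)`. Since `H̃` normalizes `Ñ±`, the last factor lies in `Ñ₊` and fixes
`v`. The first lies in `Ñ₋`; its hermitian conjugate lies in `Ñ₊`, so it fixes `u` once moved across
the form. What is left is `⟨u, γ v⟩`. The other side is built from `μ±` and `γ±`, so it sees `φ`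
only through `φ±`.

Two facts need Lie theory: the normalization (`conj_mem_connectedSubgroup`) and `Σ(Ñ₋) ⊆ Ñ₊`
(`IsGradedConjugation.map_NMinus`). Both rest on `map_connectedSubgroup_le`: a homomorphism whose
differential at `1` sends `k` into `l` sends the subgroup generated by `exp k` into that generated
by `exp l`. For conjugations one must also know that `Ad(H̃)` preserves the nilpotent subalgebras.
Along a one-parameter subgroup `c` with velocity `v`, `Ad (c t)` is `exp (t ad v)`, which preserves
every subspace stable under `ad v`. That the derivative of `Ad` is `ad` is computed in the chart at
the identity, where both are expressed by the second derivative of the multiplication. -/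

theorem mfderiv_eq_fderiv {𝕜 E F X Y : Type*} [NontriviallyNormedField 𝕜]
    [NormedAddCommGroup E] [NormedSpace 𝕜 E] [NormedAddCommGroup F] [NormedSpace 𝕜 F]
    [TopologicalSpace X] [ChartedSpace E X] [TopologicalSpace Y] [ChartedSpace F Y]
    {f : X → Y} {p : X} (hf : MDifferentiableAt 𝓘(𝕜, E) 𝓘(𝕜, F) f p) :
    (mfderiv 𝓘(𝕜, E) 𝓘(𝕜, F) f p : E →L[𝕜] F) =
      fderiv 𝕜 (extChartAt 𝓘(𝕜, F) (f p) ∘ f ∘ (extChartAt 𝓘(𝕜, E) p).symm)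
        (extChartAt 𝓘(𝕜, E) p p) := by
  have h := hf.mfderiv
  have h' : fderivWithin 𝕜 (writtenInExtChartAt 𝓘(𝕜, E) 𝓘(𝕜, F) p f) (range 𝓘(𝕜, E))
      (extChartAt 𝓘(𝕜, E) p p) = fderiv 𝕜 (extChartAt 𝓘(𝕜, F) (f p) ∘ f ∘
        (extChartAt 𝓘(𝕜, E) p).symm) (extChartAt 𝓘(𝕜, E) p p) := by
    rw [modelWithCornersSelf_coe, range_id, fderivWithin_univ]
    rfl
  exact Eq.trans h h'

/-! ### The multiplication in the chart at the identity, and the Lie bracket. -/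

section ChartMul

variable {E : Type*} [NormedAddCommGroup E] [NormedSpace ℂ E]
  {G : Type*} [TopologicalSpace G] [ChartedSpace E G] [Group G]

variable (E G) in
/-- The preferred chart at the identity. -/
abbrev chartOne : PartialEquiv G E := extChartAt 𝓘(ℂ, E) (1 : G)

variable (E G) in
/-- The multiplication of `G` read in the preferred chart at the identity. -/
def chartMul (p : E × E) : E :=
  chartOne E G ((chartOne E G).symm p.1 * (chartOne E G).symm p.2)

theorem chartOne_symm_one : (chartOne E G).symm (chartOne E G 1) = 1 :=
  extChartAt_to_inv (I := 𝓘(ℂ, E)) (1 : G)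

theorem chartMul_one_right {x : E} (hx : x ∈ (chartOne E G).target) :
    chartMul E G (x, chartOne E G 1) = x := by
  simp only [chartMul, chartOne_symm_one, mul_one]
  exact (chartOne E G).right_inv hx

theorem chartMul_one_left {x : E} (hx : x ∈ (chartOne E G).target) :
    chartMul E G (chartOne E G 1, x) = x := by
  simp only [chartMul, chartOne_symm_one, one_mul]
  exact (chartOne E G).right_inv hx

theorem eventually_mem_chartOne_target :
    ∀ᶠ x in 𝓝 (chartOne E G 1), x ∈ (chartOne E G).target :=
  extChartAt_target_mem_nhds (I := 𝓘(ℂ, E)) (1 : G)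

theorem eventually_mem_chartOne_source : ∀ᶠ g in 𝓝 (1 : G), g ∈ (chartOne E G).source :=
  extChartAt_source_mem_nhds (I := 𝓘(ℂ, E)) (1 : G)

theorem continuousAt_chartOne_symm :
    ContinuousAt (chartOne E G).symm (chartOne E G 1) :=
  continuousAt_extChartAt_symm (I := 𝓘(ℂ, E)) (1 : G)

theorem continuousAt_chartOne : ContinuousAt (chartOne E G) 1 :=
  continuousAt_extChartAt (I := 𝓘(ℂ, E)) (1 : G)

variable [LieGroup 𝓘(ℂ, E) ω G]

theorem contDiffAt_chartMul :
    ContDiffAt ℂ ω (chartMul E G) (chartOne E G 1, chartOne E G 1) := by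
  rw [← contMDiffAt_iff_contDiffAt]
  have : IsManifold 𝓘(ℂ, E) ω G := ContMDiffMul.toIsManifold
  have hs : ContMDiffAt 𝓘(ℂ, E) 𝓘(ℂ, E) ω (chartOne E G).symm (chartOne E G 1) :=
    (contMDiffOn_extChartAt_symm (I := 𝓘(ℂ, E)) (n := ω) (1 : G)).contMDiffAt
      (extChartAt_target_mem_nhds (I := 𝓘(ℂ, E)) (1 : G))
  have h1 : ContMDiffAt 𝓘(ℂ, E × E) 𝓘(ℂ, E) ω
      (fun p : E × E => (chartOne E G).symm p.1) (chartOne E G 1, chartOne E G 1) :=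
    ContMDiffAt.comp (I' := 𝓘(ℂ, E)) (chartOne E G 1, chartOne E G 1)
      (g := (chartOne E G).symm) (f := Prod.fst) hs contDiffAt_fst.contMDiffAt
  have h2 : ContMDiffAt 𝓘(ℂ, E × E) 𝓘(ℂ, E) ω
      (fun p : E × E => (chartOne E G).symm p.2) (chartOne E G 1, chartOne E G 1) :=
    ContMDiffAt.comp (I' := 𝓘(ℂ, E)) (chartOne E G 1, chartOne E G 1)
      (g := (chartOne E G).symm) (f := Prod.snd) hs contDiffAt_snd.contMDiffAt
  have h3 := h1.mul h2
  have h4 : ContMDiffAt 𝓘(ℂ, E) 𝓘(ℂ, E) ω (chartOne E G) 1 :=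
    contMDiffAt_extChartAt (I := 𝓘(ℂ, E)) (n := ω)
  refine ContMDiffAt.comp (I' := 𝓘(ℂ, E)) (chartOne E G 1, chartOne E G 1)
      (g := chartOne E G)
      (f := fun p : E × E => (chartOne E G).symm p.1 * (chartOne E G).symm p.2) ?_ h3
  simpa only [chartOne_symm_one, mul_one] using h4

theorem eventually_contDiffAt_chartMul :
    ∀ᶠ p in 𝓝 (chartOne E G 1, chartOne E G 1), ContDiffAt ℂ ω (chartMul E G) p :=
  contDiffAt_chartMul.eventually (by simp)

theorem hasFDerivAt_chartMul :
    HasFDerivAt (chartMul E G) (fderiv ℂ (chartMul E G) (chartOne E G 1, chartOne E G 1))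
      (chartOne E G 1, chartOne E G 1) :=
  (contDiffAt_chartMul.differentiableAt (by simp)).hasFDerivAt

theorem fderiv_chartMul_inl (v : E) :
    fderiv ℂ (chartMul E G) (chartOne E G 1, chartOne E G 1) (v, 0) = v := by
  have h := HasFDerivAt.comp (f := fun x : E => (id x, chartOne E G 1)) (chartOne E G 1)
    (hasFDerivAt_chartMul (E := E) (G := G))
    ((hasFDerivAt_id (𝕜 := ℂ) (chartOne E G 1)).prodMk (hasFDerivAt_const _ (chartOne E G 1)))
  have h' : HasFDerivAt (chartMul E G ∘ fun x => (id x, chartOne E G 1))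
      (ContinuousLinearMap.id ℂ E) (chartOne E G 1) :=
    (hasFDerivAt_id (chartOne E G 1)).congr_of_eventuallyEq <|
      eventually_mem_chartOne_target.mono fun x hx => chartMul_one_right hx
  simpa using DFunLike.congr_fun (h.unique h') v

theorem fderiv_chartMul_inr (v : E) :
    fderiv ℂ (chartMul E G) (chartOne E G 1, chartOne E G 1) (0, v) = v := by
  have h := HasFDerivAt.comp (f := fun x : E => (chartOne E G 1, id x)) (chartOne E G 1)
    (hasFDerivAt_chartMul (E := E) (G := G))
    ((hasFDerivAt_const (𝕜 := ℂ) (chartOne E G 1) (chartOne E G 1)).prodMk (hasFDerivAt_id _))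
  have h' : HasFDerivAt (chartMul E G ∘ fun x => (chartOne E G 1, id x))
      (ContinuousLinearMap.id ℂ E) (chartOne E G 1) :=
    (hasFDerivAt_id (chartOne E G 1)).congr_of_eventuallyEq <|
      eventually_mem_chartOne_target.mono fun x hx => chartMul_one_left hx
  simpa using DFunLike.congr_fun (h.unique h') v

variable (E G) in
/-- The second derivative at the identity of the multiplication, read in the chart. -/
def chartMulSecond : E × E →L[ℂ] E × E →L[ℂ] E :=
  fderiv ℂ (fderiv ℂ (chartMul E G)) (chartOne E G 1, chartOne E G 1)

theorem hasFDerivAt_fderiv_chartMul :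
    HasFDerivAt (fderiv ℂ (chartMul E G)) (chartMulSecond E G)
      (chartOne E G 1, chartOne E G 1) :=
  ((contDiffAt_chartMul.fderiv_right (m := 1) (by simp)).differentiableAt (by simp)).hasFDerivAt

theorem chartMulSecond_symm (a b : E × E) :
    chartMulSecond E G a b = chartMulSecond E G b a :=
  (contDiffAt_chartMul (E := E) (G := G)).isSymmSndFDerivAt_of_omega a b

/-- A left-invariant vector field read in the chart at the identity. -/
theorem mpullbackWithin_mulInvariantVectorField (v : GroupLieAlgebra 𝓘(ℂ, E) G) :
    ∀ᶠ x in 𝓝 (chartOne E G 1),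
      (mpullbackWithin 𝓘(ℂ, E) 𝓘(ℂ, E) (chartOne E G).symm (mulInvariantVectorField v)
        (range 𝓘(ℂ, E)) x : E) = fderiv ℂ (chartMul E G) (x, chartOne E G 1) (0, (v : E)) := by
  have : IsManifold 𝓘(ℂ, E) ω G := ContMDiffMul.toIsManifold
  have : IsManifold 𝓘(ℂ, E) 1 G := IsManifold.of_le (n := ω) (by simp)
  have hc : ContinuousAt (fun x : E => (x, chartOne E G 1)) (chartOne E G 1) := by fun_prop
  filter_upwards [eventually_mem_chartOne_target,
    hc.eventually (eventually_contDiffAt_chartMul (E := E) (G := G))] with x hx hm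
  set g : G := (chartOne E G).symm x with hg
  have hgs : g ∈ (chartAt E (1 : G)).source := by
    rw [← extChartAt_source 𝓘(ℂ, E)]
    exact (chartOne E G).map_target hx
  -- The differentials of the chart and of its inverse are mutually inverse, so pulling back by the
  -- inverse chart is pushing forward by the chart.
  have hinv : (mfderivWithin 𝓘(ℂ, E) 𝓘(ℂ, E) (chartOne E G).symm (range 𝓘(ℂ, E)) x).inverse =
      mfderiv 𝓘(ℂ, E) 𝓘(ℂ, E) (chartOne E G) g :=
    ContinuousLinearMap.inverse_eq (mfderivWithin_extChartAt_symm_comp_mfderiv_extChartAt hx)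
      (mfderiv_extChartAt_comp_mfderivWithin_extChartAt_symm hx)
  have hmul : MDifferentiableAt 𝓘(ℂ, E) 𝓘(ℂ, E) (fun h : G => g * h) 1 :=
    (contMDiff_mul_left (I := 𝓘(ℂ, E)) (n := ω)).contMDiffAt.mdifferentiableAt (by simp)
  have hch : MDifferentiableAt 𝓘(ℂ, E) 𝓘(ℂ, E) (chartOne E G) (g * 1) := by
    rw [mul_one]
    exact mdifferentiableAt_extChartAt hgs
  have hcomp := mfderiv_comp (1 : G) hch hmul
  have hwr : (mfderiv 𝓘(ℂ, E) 𝓘(ℂ, E) ((chartOne E G : G → E) ∘ fun h : G => g * h) 1 : E →L[ℂ] E)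
      = fderiv ℂ (fun y => chartMul E G (x, y)) (chartOne E G 1) :=
    mfderiv_eq_fderiv (hch.comp (1 : G) hmul)
  have hpart : fderiv ℂ (fun y => chartMul E G (x, y)) (chartOne E G 1) (v : E) =
      fderiv ℂ (chartMul E G) (x, chartOne E G 1) (0, (v : E)) := by
    have h := HasFDerivAt.comp (f := fun y : E => (x, y)) (chartOne E G 1)
      ((hm.differentiableAt (by simp)).hasFDerivAt)
      ((hasFDerivAt_const (𝕜 := ℂ) x (chartOne E G 1)).prodMk (hasFDerivAt_id _))
    exact DFunLike.congr_fun h.fderiv (v : E)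
  have hfin : mpullbackWithin 𝓘(ℂ, E) 𝓘(ℂ, E) (chartOne E G).symm (mulInvariantVectorField v)
        (range 𝓘(ℂ, E)) x = (mfderiv 𝓘(ℂ, E) 𝓘(ℂ, E)
          ((chartOne E G : G → E) ∘ fun h : G => g * h) 1 : E →L[ℂ] E) (v : E) := by
    rw [hcomp, mul_one, mpullbackWithin_apply, hinv]
    rfl
  exact hfin.trans ((DFunLike.congr_fun hwr v).trans hpart)

/-- At the identity the two fields take the values `v` and `w`, so differentiating each along the
other leaves only mixed second derivatives. -/
theorem lieBracket_fderiv_chartMul (v w : E) :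
    lieBracket ℂ (fun x : E => fderiv ℂ (chartMul E G) (x, chartOne E G 1) (0, v))
        (fun x : E => fderiv ℂ (chartMul E G) (x, chartOne E G 1) (0, w)) (chartOne E G 1) =
      chartMulSecond E G (v, 0) (0, w) - chartMulSecond E G (w, 0) (0, v) := by
  have key (u : E) : HasFDerivAt
      (fun x : E => fderiv ℂ (chartMul E G) (x, chartOne E G 1) (0, u))
      ((((ContinuousLinearMap.apply ℂ E ((0 : E), u)).comp (chartMulSecond E G))).comp
        (ContinuousLinearMap.inl ℂ E E)) (chartOne E G 1) := by
    have h := HasFDerivAt.comp (f := fun x : E => (x, chartOne E G 1)) (chartOne E G 1)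
      (hasFDerivAt_fderiv_chartMul (E := E) (G := G))
      ((hasFDerivAt_id (𝕜 := ℂ) (chartOne E G 1)).prodMk (hasFDerivAt_const _ (chartOne E G 1)))
    exact ((ContinuousLinearMap.apply ℂ E ((0 : E), u)).hasFDerivAt.comp _ h)
  rw [lieBracket, fderiv_chartMul_inr, fderiv_chartMul_inr, (key w).fderiv, (key v).fderiv]
  rfl

/-- The bracket of the Lie algebra in terms of the second derivative of the multiplication. -/
theorem lie_eq_chartMulSecond (v w : GroupLieAlgebra 𝓘(ℂ, E) G) :
    (⁅v, w⁆ : GroupLieAlgebra 𝓘(ℂ, E) G) =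
      chartMulSecond E G ((v : E), 0) (0, (w : E)) -
        chartMulSecond E G ((w : E), 0) (0, (v : E)) := by
  have : IsManifold 𝓘(ℂ, E) ω G := ContMDiffMul.toIsManifold
  have : IsManifold 𝓘(ℂ, E) 1 G := IsManifold.of_le (n := ω) (by simp)
  have hset : (chartOne E G).symm ⁻¹' univ ∩ range 𝓘(ℂ, E) = univ := by simp
  have hbr (X Y : E → E) : lieBracketWithin ℂ X Y
      ((chartOne E G).symm ⁻¹' univ ∩ range 𝓘(ℂ, E)) (chartOne E G 1) =
      lieBracket ℂ X Y (chartOne E G 1) := by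
    rw [hset, lieBracketWithin_univ]
  -- The tangent space at `1` is itself read through this chart, so the outer pullback in the
  -- bracket is the identity.
  have h1 : (mfderiv 𝓘(ℂ, E) 𝓘(ℂ, E) (chartOne E G) 1).inverse = ContinuousLinearMap.id ℂ E :=
    (congrArg (ContinuousLinearMap.inverse (R := ℂ) (M := E) (M₂ := E))
      (mfderiv_extChartAt_self (I := 𝓘(ℂ, E)) (x := (1 : G)))).trans
      (ContinuousLinearMap.inverse_id (R := ℂ) (M := E))
  exact (DFunLike.congr_fun h1 _).trans <| (hbr _ _).trans <|
    (Filter.EventuallyEq.lieBracket_vectorField_eq (𝕜 := ℂ) (E := E)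
      (mpullbackWithin_mulInvariantVectorField v)
      (mpullbackWithin_mulInvariantVectorField w)).trans (lieBracket_fderiv_chartMul (E := E) (G := G) v w)

end ChartMul

theorem hasFDerivAt_of_hasMFDerivAt {𝕜 E F X Y : Type*} [NontriviallyNormedField 𝕜]
    [NormedAddCommGroup E] [NormedSpace 𝕜 E] [NormedAddCommGroup F] [NormedSpace 𝕜 F]
    [TopologicalSpace X] [ChartedSpace E X] [TopologicalSpace Y] [ChartedSpace F Y]
    {f : X → Y} {p : X} {f' : E →L[𝕜] F} (hf : HasMFDerivAt 𝓘(𝕜, E) 𝓘(𝕜, F) f p f') :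
    HasFDerivAt (extChartAt 𝓘(𝕜, F) (f p) ∘ f ∘ (extChartAt 𝓘(𝕜, E) p).symm) f'
      (extChartAt 𝓘(𝕜, E) p p) := by
  have h : HasFDerivWithinAt (writtenInExtChartAt 𝓘(𝕜, E) 𝓘(𝕜, F) p f) f' (range 𝓘(𝕜, E))
    (extChartAt 𝓘(𝕜, E) p p) := hf.2
  rw [modelWithCornersSelf_coe, range_id] at h
  exact hasFDerivWithinAt_univ.1 h

/-- Where both factors equal `1` noncommutativity plays no part in the quotient rule. It serves for
`Ad`, which near `1` is such a quotient of partial derivatives of the multiplication. -/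
theorem hasFDerivAt_ringInverse_mul {A V : Type*} [NormedRing A] [NormedAlgebra ℂ A]
    [HasSummableGeomSeries A] [NormedAddCommGroup V] [NormedSpace ℂ V] {b c : V → A}
    {b' c' : V →L[ℂ] A} {x : V} (hb : HasFDerivAt b b' x) (hc : HasFDerivAt c c' x)
    (hb1 : b x = 1) (hc1 : c x = 1) :
    HasFDerivAt (fun y => Ring.inverse (b y) * c y) (c' - b') x := by
  have hinv := hasFDerivAt_ringInverse (𝕜 := ℂ) (1 : Aˣ)
  rw [Units.val_one, ← hb1] at hinv
  refine ((hinv.comp x hb).mul' hc).congr_fderiv ?_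
  ext v
  simp [hb1, hc1, sub_eq_add_neg]

/-! ### The derivative of `Ad` is the bracket; one-parameter groups of operators. -/

section AdjointAction

variable {E : Type*} [NormedAddCommGroup E] [NormedSpace ℂ E]
  {G : Type*} [TopologicalSpace G] [ChartedSpace E G] [Group G]

variable (E) in
/-- The adjoint action of `g` as a continuous linear endomorphism of the model space. -/
def adCLM (g : G) : E →L[ℂ] E :=
  mfderiv 𝓘(ℂ, E) 𝓘(ℂ, E) (fun h : G => g * h * g⁻¹) 1

theorem adCLM_apply (g : G) (x : GroupLieAlgebra 𝓘(ℂ, E) G) : adCLM E g x = Ad g x := rfl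

theorem adCLM_one : adCLM E (1 : G) = 1 := by
  have hfun : (fun k : G => (1 : G) * k * (1 : G)⁻¹) = id := by
    funext k
    simp
  have h : mfderiv 𝓘(ℂ, E) 𝓘(ℂ, E) (fun k : G => (1 : G) * k * (1 : G)⁻¹) 1 =
    ContinuousLinearMap.id ℂ E := by
    rw [hfun]
    exact mfderiv_id
  exact h

variable [LieGroup 𝓘(ℂ, E) ω G]

theorem contMDiff_conj (g : G) :
    ContMDiff 𝓘(ℂ, E) 𝓘(ℂ, E) ω (fun h : G => g * h * g⁻¹) :=
  (contMDiff_mul_right (I := 𝓘(ℂ, E)) (a := g⁻¹)).comp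
    (contMDiff_mul_left (I := 𝓘(ℂ, E)) (a := g))

theorem mdifferentiableAt_conj (g h : G) :
    MDifferentiableAt 𝓘(ℂ, E) 𝓘(ℂ, E) (fun h : G => g * h * g⁻¹) h :=
  (contMDiff_conj g).contMDiffAt.mdifferentiableAt (by simp)

theorem adCLM_mul (g h : G) : adCLM E (g * h) = adCLM E g * adCLM E h := by
  have hg (k : G) (hk : k = 1) : HasMFDerivAt 𝓘(ℂ, E) 𝓘(ℂ, E) (fun k : G => g * k * g⁻¹) k
      (adCLM E g : E →L[ℂ] E) := by
    subst hk
    exact (mdifferentiableAt_conj (E := E) g 1).hasMFDerivAt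
  have hc := HasMFDerivAt.comp (1 : G) (hg (h * 1 * h⁻¹) (by simp))
    (mdifferentiableAt_conj (E := E) h 1).hasMFDerivAt
  have hfun : (fun k : G => g * k * g⁻¹) ∘ (fun k : G => h * k * h⁻¹) =
      fun k : G => (g * h) * k * (g * h)⁻¹ := by
    funext k
    simp [mul_assoc]
  rw [hfun] at hc
  exact hc.mfderiv

theorem hasFDerivAt_conj (g : G) :
    HasFDerivAt (fun y : E => chartOne E G (g * (chartOne E G).symm y * g⁻¹))
      (adCLM E g) (chartOne E G 1) := by
  have h := hasFDerivAt_of_hasMFDerivAt (mdifferentiableAt_conj (E := E) g 1).hasMFDerivAt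
  have h1 : g * 1 * g⁻¹ = 1 := by simp
  simp only [h1] at h
  exact h

/-- The adjoint action near the identity, in terms of the multiplication read in the chart. -/
theorem eventually_fderiv_chartMul_conj :
    ∀ᶠ g in 𝓝 (1 : G),
      (fderiv ℂ (chartMul E G) (chartOne E G g, chartOne E G 1)).comp
          (ContinuousLinearMap.inr ℂ E E) =
        ((fderiv ℂ (chartMul E G) (chartOne E G 1, chartOne E G g)).comp
          (ContinuousLinearMap.inl ℂ E E)).comp (adCLM E g) := by
  have h0 : ContinuousAt (chartOne E G) 1 := continuousAt_chartOne
  have hr : ContinuousAt (fun g : G => (chartOne E G g, chartOne E G 1)) 1 :=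
    h0.prodMk continuousAt_const
  have hl : ContinuousAt (fun g : G => (chartOne E G 1, chartOne E G g)) 1 :=
    continuousAt_const.prodMk h0
  filter_upwards [eventually_mem_chartOne_source (E := E),
    hr.eventually (eventually_contDiffAt_chartMul (E := E) (G := G)),
    hl.eventually (eventually_contDiffAt_chartMul (E := E) (G := G))] with g hg hgr hgl
  have hconj := hasFDerivAt_conj (E := E) g
  have hC1 : chartOne E G (g * (chartOne E G).symm (chartOne E G 1) * g⁻¹) = chartOne E G 1 := by
    rw [chartOne_symm_one, mul_one, mul_inv_cancel]
  have h1 := HasFDerivAt.comp (f := fun y : E => (chartOne E G g, y)) (chartOne E G 1)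
    ((hgr.differentiableAt (by simp)).hasFDerivAt)
    ((hasFDerivAt_const (𝕜 := ℂ) (chartOne E G g) (chartOne E G 1)).prodMk (hasFDerivAt_id _))
  have h2 := HasFDerivAt.comp (g := chartMul E G)
    (f := fun y : E => (chartOne E G (g * (chartOne E G).symm y * g⁻¹), chartOne E G g))
    (g' := fderiv ℂ (chartMul E G) (chartOne E G 1, chartOne E G g)) (chartOne E G 1)
    (by rw [hC1]; exact (hgl.differentiableAt (by simp)).hasFDerivAt)
    (hconj.prodMk (hasFDerivAt_const (𝕜 := ℂ) (chartOne E G g) (chartOne E G 1)))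
  have hG : IsTopologicalGroup G := topologicalGroup_of_lieGroup 𝓘(ℂ, E) ω
  have hsrc : ∀ᶠ y in 𝓝 (chartOne E G 1),
      g * (chartOne E G).symm y * g⁻¹ ∈ (chartOne E G).source := by
    have hcont : ContinuousAt (fun y => g * (chartOne E G).symm y * g⁻¹) (chartOne E G 1) :=
      (continuousAt_const.mul continuousAt_chartOne_symm).mul continuousAt_const
    refine hcont.eventually ?_
    simp only [chartOne_symm_one, mul_one, mul_inv_cancel]
    exact eventually_mem_chartOne_source
  -- This is `g h = (g h g⁻¹) g` read in the chart; the relation follows by differentiating both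
  -- sides in `h` at `1`.
  have heq : (chartMul E G ∘ fun y : E => (chartOne E G g, y)) =ᶠ[𝓝 (chartOne E G 1)]
      (chartMul E G ∘
        fun y : E => (chartOne E G (g * (chartOne E G).symm y * g⁻¹), chartOne E G g)) := by
    filter_upwards [hsrc] with y hy
    simp only [Function.comp_apply, chartMul]
    rw [(chartOne E G).left_inv hg, (chartOne E G).left_inv hy, inv_mul_cancel_right]
  exact h1.unique (h2.congr_of_eventuallyEq heq)

variable (E G) in
/-- The adjoint action near the identity, read in the chart. -/
def adChart (x : E) : E →L[ℂ] E :=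
  Ring.inverse ((fderiv ℂ (chartMul E G) (chartOne E G 1, x)).comp (ContinuousLinearMap.inl ℂ E E))
    * (fderiv ℂ (chartMul E G) (x, chartOne E G 1)).comp (ContinuousLinearMap.inr ℂ E E)

theorem hasFDerivAt_fderiv_chartMul_right : HasFDerivAt
    (fun x => (fderiv ℂ (chartMul E G) (x, chartOne E G 1)).comp (ContinuousLinearMap.inr ℂ E E))
    (((ContinuousLinearMap.compL ℂ E (E × E) E).flip (ContinuousLinearMap.inr ℂ E E)).comp
      ((chartMulSecond E G).comp (ContinuousLinearMap.inl ℂ E E))) (chartOne E G 1) := by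
  have h := HasFDerivAt.comp (f := fun x : E => (x, chartOne E G 1)) (chartOne E G 1)
    (hasFDerivAt_fderiv_chartMul (E := E) (G := G))
    ((hasFDerivAt_id (𝕜 := ℂ) (chartOne E G 1)).prodMk (hasFDerivAt_const _ (chartOne E G 1)))
  exact ((ContinuousLinearMap.compL ℂ E (E × E) E).flip
    (ContinuousLinearMap.inr ℂ E E)).hasFDerivAt.comp _ h

theorem hasFDerivAt_fderiv_chartMul_left : HasFDerivAt
    (fun x => (fderiv ℂ (chartMul E G) (chartOne E G 1, x)).comp (ContinuousLinearMap.inl ℂ E E))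
    (((ContinuousLinearMap.compL ℂ E (E × E) E).flip (ContinuousLinearMap.inl ℂ E E)).comp
      ((chartMulSecond E G).comp (ContinuousLinearMap.inr ℂ E E))) (chartOne E G 1) := by
  have h := HasFDerivAt.comp (f := fun x : E => (chartOne E G 1, x)) (chartOne E G 1)
    (hasFDerivAt_fderiv_chartMul (E := E) (G := G))
    ((hasFDerivAt_const (𝕜 := ℂ) (chartOne E G 1) (chartOne E G 1)).prodMk (hasFDerivAt_id _))
  exact ((ContinuousLinearMap.compL ℂ E (E × E) E).flip
    (ContinuousLinearMap.inl ℂ E E)).hasFDerivAt.comp _ h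

theorem fderiv_chartMul_comp_inl :
    (fderiv ℂ (chartMul E G) (chartOne E G 1, chartOne E G 1)).comp
      (ContinuousLinearMap.inl ℂ E E) = 1 := by
  ext v
  exact fderiv_chartMul_inl v

theorem fderiv_chartMul_comp_inr :
    (fderiv ℂ (chartMul E G) (chartOne E G 1, chartOne E G 1)).comp
      (ContinuousLinearMap.inr ℂ E E) = 1 := by
  ext v
  exact fderiv_chartMul_inr v

/-- Both partial derivatives in `adChart` are `1` at the identity, so the derivative is a difference
of mixed second derivatives; symmetry of the second derivative turns it into the bracket. -/
theorem hasFDerivAt_adChart [CompleteSpace E] : ∃ L : E →L[ℂ] E →L[ℂ] E,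
    HasFDerivAt (adChart E G) L (chartOne E G 1) ∧
    ∀ v w : GroupLieAlgebra 𝓘(ℂ, E) G, L v w = (⁅v, w⁆ : GroupLieAlgebra 𝓘(ℂ, E) G) := by
  have h := hasFDerivAt_ringInverse_mul (hasFDerivAt_fderiv_chartMul_left (E := E) (G := G))
    (hasFDerivAt_fderiv_chartMul_right (E := E) (G := G)) fderiv_chartMul_comp_inl
    fderiv_chartMul_comp_inr
  refine ⟨_, h, fun v w => ?_⟩
  rw [lie_eq_chartMulSecond, ← chartMulSecond_symm (E := E) (G := G) (0, v) (w, 0)]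
  rfl

/-- `Ring.inverse` is a genuine inverse only at units. Units form an open set, and the operator
inverted is `1` at the identity. -/
theorem eventually_adCLM_eq_adChart [CompleteSpace E] :
    ∀ᶠ g in 𝓝 (1 : G), adCLM E g = adChart E G (chartOne E G g) := by
  have hB : ContinuousAt (fun g : G => (fderiv ℂ (chartMul E G)
      (chartOne E G 1, chartOne E G g)).comp (ContinuousLinearMap.inl ℂ E E)) 1 :=
    ContinuousAt.comp (g := fun x => (fderiv ℂ (chartMul E G) (chartOne E G 1, x)).comp
      (ContinuousLinearMap.inl ℂ E E)) (f := chartOne E G)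
      (hasFDerivAt_fderiv_chartMul_left (E := E) (G := G)).continuousAt continuousAt_chartOne
  have hU : ∀ᶠ g in 𝓝 (1 : G), IsUnit ((fderiv ℂ (chartMul E G)
      (chartOne E G 1, chartOne E G g)).comp (ContinuousLinearMap.inl ℂ E E)) := by
    refine hB.eventually (Units.isOpen.mem_nhds ?_)
    exact (congrArg IsUnit fderiv_chartMul_comp_inl).mpr isUnit_one
  filter_upwards [hU, eventually_fderiv_chartMul_conj (E := E) (G := G)] with g hg hconj
  rw [adChart, hconj]
  exact (Ring.inverse_mul_cancel_left _ _ hg).symm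

/-- The derivative at `0` of the adjoint action along a curve through the identity, provided the
curve is differentiable in the chart. -/
theorem hasDerivAt_adCLM [CompleteSpace E] {d : ℝ → G} {v : GroupLieAlgebra 𝓘(ℂ, E) G}
    (h0 : d 0 = 1) (hc : ContinuousAt d 0)
    (hd : HasDerivAt (fun t => chartOne E G (d t)) (v : E) 0) :
    ∃ L : E →L[ℂ] E, HasDerivAt (fun t => adCLM E (d t)) L 0 ∧
      ∀ w : GroupLieAlgebra 𝓘(ℂ, E) G, L w = (⁅v, w⁆ : GroupLieAlgebra 𝓘(ℂ, E) G) := by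
  obtain ⟨L, hL, hLie⟩ := hasFDerivAt_adChart (E := E) (G := G)
  refine ⟨L v, ?_, hLie v⟩
  rw [← h0] at hL
  have h := (hL.restrictScalars ℝ).comp_hasDerivAt (f := fun t => chartOne E G (d t)) 0 hd
  refine h.congr_of_eventuallyEq ?_
  have := eventually_adCLM_eq_adChart (E := E) (G := G)
  rw [← h0] at this
  exact hc.eventually this

/-- The partial sums of the exponential series stay in `k`, and `k` is closed by finite
dimensionality. -/
theorem exp_apply_mem {A : Type*} [NormedAddCommGroup A] [NormedSpace ℂ A]
    [FiniteDimensional ℂ A] (L : A →L[ℂ] A) (k : Submodule ℂ A) (hk : ∀ w ∈ k, L w ∈ k) {w : A}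
    (hw : w ∈ k) : NormedSpace.exp L w ∈ k := by
  have : CompleteSpace A := FiniteDimensional.complete ℂ A
  have hpow (n : ℕ) : (L ^ n) w ∈ k := by
    induction n with
    | zero => simpa using hw
    | succ n ih =>
      rw [pow_succ']
      exact hk _ ih
  have hs := (NormedSpace.exp_series_hasSum_exp' (𝕂 := ℂ) L).mapL
    (ContinuousLinearMap.apply ℂ A w)
  exact (Submodule.closed_of_finiteDimensional k).mem_of_tendsto hs
    (Filter.Eventually.of_forall fun s => k.sum_mem fun n _ => k.smul_mem _ (hpow n))

/-- A differentiable one-parameter group of operators is the exponential of its generator. -/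
theorem eq_exp_of_hasDerivAt {A : Type*} [NormedRing A] [NormedAlgebra ℝ A] [CompleteSpace A]
    {a : ℝ → A} {L : A} (h0 : a 0 = 1) (hmul : ∀ s t, a (s + t) = a s * a t)
    (hd : HasDerivAt a L 0) (t : ℝ) : a t = NormedSpace.exp (t • L) := by
  have hd' (t : ℝ) : HasDerivAt a (a t * L) t := by
    have h1 : HasDerivAt (fun s => a t * a (s - t)) (a t * L) t := by
      have : HasDerivAt (fun s => a (s - t)) L t := by
        have := HasDerivAt.comp_sub_const (f := a) t t (by simpa using hd)
        exact this
      exact this.const_mul (a t)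
    refine h1.congr_of_eventuallyEq (Filter.Eventually.of_forall fun s => ?_)
    change a s = a t * a (s - t)
    rw [← hmul]
    congr 1
    ring
  have hexp (t : ℝ) : HasDerivAt (fun t : ℝ => NormedSpace.exp ((-t) • L))
      (-(L * NormedSpace.exp ((-t) • L))) t := by
    have h := (hasDerivAt_exp_smul_const' (𝕂 := ℝ) L (-t)).scomp t (hasDerivAt_neg t)
    simpa [Function.comp_def] using h
  -- The product `a t * exp (-t L)` has zero derivative, hence is constantly `1`.
  have hprod (t : ℝ) : HasDerivAt (fun t => a t * NormedSpace.exp ((-t) • L)) 0 t := by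
    have h := (hd' t).mul (hexp t)
    refine h.congr_deriv ?_
    rw [mul_neg, mul_assoc]
    exact add_neg_cancel _
  have hconst : a t * NormedSpace.exp ((-t) • L) = 1 := by
    have h := is_const_of_deriv_eq_zero (fun t => (hprod t).differentiableAt)
      (fun t => (hprod t).deriv) t 0
    simpa [h0] using h
  have hinv : NormedSpace.exp ((-t) • L) * NormedSpace.exp (t • L) = 1 := by
    let : NormedAlgebra ℚ A := NormedAlgebra.restrictScalars ℚ ℝ A
    rw [← NormedSpace.exp_add_of_commute, neg_smul, neg_add_cancel, NormedSpace.exp_zero]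
    exact ((Commute.refl L).smul_left _).smul_right _
  calc a t = a t * (NormedSpace.exp ((-t) • L) * NormedSpace.exp (t • L)) := by
        rw [hinv, mul_one]
    _ = NormedSpace.exp (t • L) := by rw [← mul_assoc, hconst, one_mul]

end AdjointAction

/-! ### From complex to real differentiability. -/

section RestrictScalars

variable {E F X Y : Type*} [NormedAddCommGroup E] [NormedSpace ℂ E] [NormedAddCommGroup F]
  [NormedSpace ℂ F] [TopologicalSpace X] [ChartedSpace E X] [TopologicalSpace Y] [ChartedSpace F Y]

theorem contMDiffAt_restrictScalars {n : ℕ∞ω} {f : X → Y} {p : X}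
    (hf : ContMDiffAt 𝓘(ℂ, E) 𝓘(ℂ, F) n f p) : ContMDiffAt 𝓘(ℝ, E) 𝓘(ℝ, F) n f p := by
  rw [contMDiffAt_iff] at hf ⊢
  exact ⟨hf.1, hf.2.restrict_scalars ℝ⟩

theorem hasMFDerivAt_restrictScalars {f : X → Y} {p : X} {f' : E →L[ℂ] F}
    (hf : HasMFDerivAt 𝓘(ℂ, E) 𝓘(ℂ, F) f p f') :
    HasMFDerivAt 𝓘(ℝ, E) 𝓘(ℝ, F) f p (f'.restrictScalars ℝ : E →L[ℝ] F) := by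
  have h : HasFDerivWithinAt (writtenInExtChartAt 𝓘(ℂ, E) 𝓘(ℂ, F) p f) f' (range 𝓘(ℂ, E))
    (extChartAt 𝓘(ℂ, E) p p) := hf.2
  exact ⟨hf.1, h.restrictScalars ℝ⟩

end RestrictScalars

theorem map_zero_eq_one {G : Type*} [Group G] {d : ℝ → G} (hmul : ∀ s t, d (s + t) = d s * d t) : d 0 = 1 := by
  have h := hmul 0 0
  rw [add_zero] at h
  exact left_eq_mul.1 h

/-! ### One-parameter subgroups and the connected subgroups they generate. -/

section OneParameter

variable {E : Type*} [NormedAddCommGroup E] [NormedSpace ℂ E]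
  {G : Type*} [TopologicalSpace G] [ChartedSpace E G] [Group G]

theorem IsOneParameterSubgroup.mdifferentiableAt {c : ℝ → G} (hc : IsOneParameterSubgroup E c)
    (t : ℝ) : MDifferentiableAt 𝓘(ℝ, ℝ) 𝓘(ℝ, E) c t :=
  hc.2.contMDiffAt.mdifferentiableAt (by simp)

theorem hasDerivAt_chartOne_comp {c : ℝ → G} (h0 : c 0 = 1)
    (hc : MDifferentiableAt 𝓘(ℝ, ℝ) 𝓘(ℝ, E) c 0) :
    HasDerivAt (fun t => chartOne E G (c t)) (initialVelocity (E := E) c : E) 0 := by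
  have h := (hasFDerivAt_of_hasMFDerivAt hc.hasMFDerivAt).hasDerivAt
  simp only [h0] at h
  exact h

theorem initialVelocity_comp {c : ℝ → G} (h0 : c 0 = 1)
    (hc : MDifferentiableAt 𝓘(ℝ, ℝ) 𝓘(ℝ, E) c 0) {f : G → G} {f' : E →L[ℝ] E}
    (hf : HasMFDerivAt 𝓘(ℝ, E) 𝓘(ℝ, E) f 1 f') :
    initialVelocity (E := E) (f ∘ c) = f' (initialVelocity (E := E) c : E) := by
  have hf' : HasMFDerivAt 𝓘(ℝ, E) 𝓘(ℝ, E) f (c 0) f' := by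
    rw [h0]
    exact hf
  have h := (HasMFDerivAt.comp (0 : ℝ) hf' hc.hasMFDerivAt).mfderiv
  exact DFunLike.congr_fun (F := ℝ →L[ℝ] E) h 1

variable [LieGroup 𝓘(ℂ, E) ω G]

/-- Differentiating `d (t + s) = d t * d s` in `s` at `0` shows that `d` solves the ordinary
differential equation of a left-invariant field. -/
theorem eventually_hasDerivAt_chartOne {d : ℝ → G} {v : E} (hmul : ∀ s t, d (s + t) = d s * d t)
    (hc : ContinuousAt d 0) (hd : HasDerivAt (fun t => chartOne E G (d t)) v 0) :
    ∀ᶠ t in 𝓝 (0 : ℝ), ContDiffAt ℂ ω (chartMul E G) (chartOne E G (d t), chartOne E G 1) ∧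
      HasDerivAt (fun t => chartOne E G (d t))
        (fderiv ℂ (chartMul E G) (chartOne E G (d t), chartOne E G 1) (0, v)) t := by
  have h0 := map_zero_eq_one hmul
  have hsrc : ∀ᶠ t in 𝓝 (0 : ℝ), d t ∈ (chartOne E G).source :=
    hc.eventually (by rw [h0]; exact eventually_mem_chartOne_source)
  have hpair : ContinuousAt (fun t => (chartOne E G (d t), chartOne E G 1)) 0 :=
    hd.continuousAt.prodMk continuousAt_const
  have hm : ∀ᶠ t in 𝓝 (0 : ℝ),
      ContDiffAt ℂ ω (chartMul E G) (chartOne E G (d t), chartOne E G 1) :=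
    hpair.eventually (by simp only [h0]; exact eventually_contDiffAt_chartMul)
  filter_upwards [hsrc, hm] with t ht hmt
  refine ⟨hmt, ?_⟩
  have h1 : HasDerivAt (fun s => chartMul E G (chartOne E G (d t), chartOne E G (d s)))
      (fderiv ℂ (chartMul E G) (chartOne E G (d t), chartOne E G 1) (0, v)) 0 := by
    have hM := ((hmt.differentiableAt (by simp)).hasFDerivAt).restrictScalars ℝ
    rw [← h0] at hM
    have := hM.comp_hasDerivAt (0 : ℝ) ((hasDerivAt_const (0 : ℝ) (chartOne E G (d t))).prodMk hd)
    rw [h0] at this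
    exact this
  have h2 : HasDerivAt (fun s => chartOne E G (d (t + s)))
      (fderiv ℂ (chartMul E G) (chartOne E G (d t), chartOne E G 1) (0, v)) 0 := by
    refine h1.congr_of_eventuallyEq ?_
    filter_upwards [hsrc] with s hs
    rw [hmul, chartMul, (chartOne E G).left_inv ht, (chartOne E G).left_inv hs]
  have h3 := HasDerivAt.comp_sub_const (f := fun s => chartOne E G (d (t + s))) t t
    (by simpa using h2)
  simpa using h3

/-- Bootstrap: the right side of the differential equation is a smooth function of the solution, so
a solution of class `C^n` has a `C^n` derivative and is of class `C^(n+1)`, on one interval-free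
open set `I` serving all `n`. -/
theorem contDiffAt_chartOne_comp {d : ℝ → G} {v : E} (hmul : ∀ s t, d (s + t) = d s * d t)
    (hc : ContinuousAt d 0) (hd : HasDerivAt (fun t => chartOne E G (d t)) v 0) :
    ContDiffAt ℝ ∞ (fun t => chartOne E G (d t)) 0 := by
  obtain ⟨I, hI, hIo, h0I⟩ := eventually_nhds_iff.1 (eventually_hasDerivAt_chartOne hmul hc hd)
  have hn (n : ℕ) : ContDiffOn ℝ n (fun t => chartOne E G (d t)) I := by
    induction n with
    | zero =>
      exact contDiffOn_zero.2 fun t ht => (hI t ht).2.continuousAt.continuousWithinAt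
    | succ n ih =>
      rw [Nat.cast_succ, contDiffOn_succ_iff_deriv_of_isOpen hIo]
      refine ⟨fun t ht => (hI t ht).2.differentiableAt.differentiableWithinAt, by simp, ?_⟩
      refine ContDiffOn.congr (f := fun t =>
        fderiv ℂ (chartMul E G) (chartOne E G (d t), chartOne E G 1) (0, v)) ?_
        fun t ht => (hI t ht).2.deriv
      intro t ht
      have h1 : ContDiffAt ℝ n (fderiv ℂ (chartMul E G))
          (chartOne E G (d t), chartOne E G 1) :=
        ((hI t ht).1.fderiv_right (m := n) (by simp)).restrict_scalars ℝ
      have h2 : ContDiffWithinAt ℝ n (fun t => (chartOne E G (d t), chartOne E G 1)) I t :=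
        (ih t ht).prodMk contDiffWithinAt_const
      have h3 := h1.comp_contDiffWithinAt t h2
      exact (((ContinuousLinearMap.apply ℂ E ((0 : E), v)).restrictScalars ℝ).contDiff
        (n := n)).comp_contDiffWithinAt h3
  exact (contDiffOn_infty.2 hn).contDiffAt (hIo.mem_nhds h0I)

/-- A homomorphism from the real line to a Lie group that is differentiable at `0` is smooth. -/
theorem isOneParameterSubgroup_of_mdifferentiableAt {d : ℝ → G}
    (hmul : ∀ s t, d (s + t) = d s * d t)
    (hd : MDifferentiableAt 𝓘(ℝ, ℝ) 𝓘(ℝ, E) d 0) : IsOneParameterSubgroup E d := by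
  refine ⟨hmul, fun t => ?_⟩
  have h0 := map_zero_eq_one hmul
  have hd0 : ContMDiffAt 𝓘(ℝ, ℝ) 𝓘(ℝ, E) ∞ d 0 := by
    rw [contMDiffAt_iff]
    refine ⟨hd.continuousAt, ?_⟩
    have h := contDiffAt_chartOne_comp hmul hd.continuousAt (hasDerivAt_chartOne_comp h0 hd)
    simp only [h0]
    exact h.contDiffWithinAt
  -- Left translation by `d t` carries smoothness from `0` to `t`, since `d s = d t * d (s - t)`.
  have hL : ContMDiffAt 𝓘(ℝ, E) 𝓘(ℝ, E) ∞ (fun g => d t * g) (d (t - t)) :=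
    contMDiffAt_restrictScalars
      ((contMDiff_mul_left (I := 𝓘(ℂ, E)) (n := ω) (a := d t)).contMDiffAt.of_le (by simp))
  have hs : ContMDiffAt 𝓘(ℝ, ℝ) 𝓘(ℝ, ℝ) ∞ (fun s : ℝ => s - t) t :=
    (contDiff_id.sub contDiff_const).contMDiff.contMDiffAt
  have hds : ContMDiffAt 𝓘(ℝ, ℝ) 𝓘(ℝ, E) ∞ (fun s : ℝ => d (s - t)) t :=
    ContMDiffAt.comp t (g := d) (f := fun s : ℝ => s - t) (by rw [sub_self]; exact hd0) hs
  have h := ContMDiffAt.comp t (g := fun g => d t * g) (f := fun s : ℝ => d (s - t)) hL hds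
  refine h.congr_of_eventuallyEq (Filter.Eventually.of_forall fun s => ?_)
  change d s = d t * d (s - t)
  rw [← hmul]
  congr 1
  ring

/-- A generating one-parameter subgroup is sent to a homomorphism from the line that is
differentiable at `0`, hence smooth. Only real differentiability of `f` at `1` enters, so
antiholomorphic automorphisms are covered along with conjugations. -/
theorem map_connectedSubgroup_le {f : G →* G} {f' : E →L[ℝ] E}
    (hf : HasMFDerivAt 𝓘(ℝ, E) 𝓘(ℝ, E) f 1 f')
    {k l : Submodule ℂ (GroupLieAlgebra 𝓘(ℂ, E) G)}
    (hkl : ∀ x : GroupLieAlgebra 𝓘(ℂ, E) G, x ∈ k → (f' (x : E) : E) ∈ l) :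
    (connectedSubgroup k).map f ≤ connectedSubgroup l := by
  rw [connectedSubgroup, MonoidHom.map_closure, Subgroup.closure_le]
  rintro _ ⟨_, ⟨c, hc, hck, rfl⟩, rfl⟩
  have h0 := map_zero_eq_one hc.1
  have hmd : MDifferentiableAt 𝓘(ℝ, ℝ) 𝓘(ℝ, E) (f ∘ c) 0 := by
    refine MDifferentiableAt.comp 0 ?_ (hc.mdifferentiableAt 0)
    rw [h0]
    exact hf.mdifferentiableAt
  refine Subgroup.subset_closure ⟨f ∘ c, isOneParameterSubgroup_of_mdifferentiableAt
    (fun s t => by simp [hc.1]) hmd, ?_, rfl⟩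
  rw [initialVelocity_comp h0 (hc.mdifferentiableAt 0) hf]
  exact hkl _ hck

variable [FiniteDimensional ℂ E]

theorem Ad_oneParameterSubgroup_mem {c : ℝ → G} (hc : IsOneParameterSubgroup E c)
    {k : Submodule ℂ (GroupLieAlgebra 𝓘(ℂ, E) G)}
    (hk : ∀ w ∈ k, ⁅initialVelocity (E := E) c, w⁆ ∈ k)
    {w : GroupLieAlgebra 𝓘(ℂ, E) G} (hw : w ∈ k) (t : ℝ) : Ad (c t) w ∈ k := by
  have : CompleteSpace E := FiniteDimensional.complete ℂ E
  have h0 := map_zero_eq_one hc.1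
  obtain ⟨L, hL, hLie⟩ := hasDerivAt_adCLM h0 (hc.mdifferentiableAt 0).continuousAt
    (hasDerivAt_chartOne_comp h0 (hc.mdifferentiableAt 0))
  have hexp : adCLM E (c t) = NormedSpace.exp (t • L) :=
    eq_exp_of_hasDerivAt (by rw [h0, adCLM_one])
    (fun s t => by rw [hc.1, adCLM_mul]) hL t
  have hmem : ∀ w : E, w ∈ (k : Submodule ℂ E) → (t • L) w ∈ (k : Submodule ℂ E) := by
    intro w hw
    have h1 : L w ∈ (k : Submodule ℂ E) := (congrArg (· ∈ k) (hLie w)).mpr (hk w hw)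
    have h2 := k.smul_mem (t : ℂ) h1
    exact h2
  rw [← adCLM_apply, hexp]
  exact exp_apply_mem (t • L) k hmem hw

theorem Ad_connectedSubgroup_mem {l k : Submodule ℂ (GroupLieAlgebra 𝓘(ℂ, E) G)}
    (hlk : ∀ v ∈ l, ∀ w ∈ k, ⁅v, w⁆ ∈ k) {h : G} (hh : h ∈ connectedSubgroup l)
    {w : GroupLieAlgebra 𝓘(ℂ, E) G} (hw : w ∈ k) : Ad h w ∈ k := by
  induction hh using Subgroup.closure_induction'' generalizing w with
  | one =>
    rw [← adCLM_apply, adCLM_one]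
    exact hw
  | mem x hx =>
    obtain ⟨c, hc, hcl, rfl⟩ := hx
    exact Ad_oneParameterSubgroup_mem hc (hlk _ hcl) hw 1
  | inv_mem x hx =>
    obtain ⟨c, hc, hcl, rfl⟩ := hx
    -- The inverse of a generator is the value at `-1` of the same one-parameter subgroup.
    have hinv : (c 1)⁻¹ = c (-1) := by
      rw [inv_eq_iff_mul_eq_one, ← hc.1, add_neg_cancel, map_zero_eq_one hc.1]
    rw [hinv]
    exact Ad_oneParameterSubgroup_mem hc (hlk _ hcl) hw (-1)
  | mul x y _ _ hx hy =>
    rw [← adCLM_apply, adCLM_mul]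
    exact hx (hy hw)

/-- If `l` normalizes `k`, the connected subgroup of `l` normalizes that of `k`. -/
theorem conj_mem_connectedSubgroup {l k : Submodule ℂ (GroupLieAlgebra 𝓘(ℂ, E) G)}
    (hlk : ∀ v ∈ l, ∀ w ∈ k, ⁅v, w⁆ ∈ k) {h n : G} (hh : h ∈ connectedSubgroup l)
    (hn : n ∈ connectedSubgroup k) : h * n * h⁻¹ ∈ connectedSubgroup k := by
  have hf : HasMFDerivAt 𝓘(ℝ, E) 𝓘(ℝ, E) (MulAut.conj h).toMonoidHom 1
      ((adCLM E h).restrictScalars ℝ : E →L[ℝ] E) :=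
    hasMFDerivAt_restrictScalars (mdifferentiableAt_conj (E := E) h 1).hasMFDerivAt
  exact map_connectedSubgroup_le hf (fun x hx => Ad_connectedSubgroup_mem hlk hh hx)
    (Subgroup.mem_map_of_mem _ hn)

end OneParameter

/-- Here `a, b` play `μ₊, μ₋`; `n, m` play `ν₋, ν₊`; `e, f` play `η₋, η₊`; `c, d` play `γ₊, γ₋`. The
middle factor is then the Toda mapping. -/
theorem inv_mul_eq_of_mul_eq {G : Type*} [Group G] {a b c d e f m n : G}
    (h : a * n * e = b * m * f) :
    (a * c)⁻¹ * (b * d) =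
      (c⁻¹ * n * c⁻¹⁻¹) * (c⁻¹ * (e * f⁻¹) * d) * (d⁻¹ * m⁻¹ * d⁻¹⁻¹) := by
  obtain rfl : b = a * n * e * f⁻¹ * m⁻¹ := by rw [h]; group
  group

/-! ### The graded subgroups and the matrix elements of Toda mappings. -/

section Grading

variable {E : Type*} [NormedAddCommGroup E] [NormedSpace ℂ E]
  {G : Type*} [TopologicalSpace G] [ChartedSpace E G] [Group G] [LieGroup 𝓘(ℂ, E) ω G]
  {gr : ℤ → Submodule ℂ (GroupLieAlgebra 𝓘(ℂ, E) G)}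

/-- The differential `σ` reverses degrees, so it exchanges negative and positive components. -/
theorem IsGradedConjugation.map_NMinus
    {σ : GroupLieAlgebra 𝓘(ℂ, E) G →ₛₗ[starRingEnd ℂ] GroupLieAlgebra 𝓘(ℂ, E) G}
    (hσ : IsGradedConjugation gr σ) {S : G ≃* G} (hS : IsAntiholomorphicExtension σ S)
    {n : G} (hn : n ∈ NMinus gr) : S n ∈ NPlus gr := by
  have hf : HasMFDerivAt 𝓘(ℝ, E) 𝓘(ℝ, E) S.toMonoidHom 1 (realDeriv E E S (1 : G)) :=
    (hS.antiholomorphic 1 (mem_univ _)).1.hasMFDerivAt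
  have hle : nMinusAlg gr ≤ (nPlusAlg gr).comap σ := by
    refine iSup₂_le fun m hm x hx => ?_
    have h : σ x ∈ gr (-m) := by
      have : σ x ∈ σ '' (gr m : Set (GroupLieAlgebra 𝓘(ℂ, E) G)) := mem_image_of_mem _ hx
      rwa [hσ.image_gr m] at this
    exact Submodule.mem_iSup_of_mem (-m) (Submodule.mem_iSup_of_mem (by omega) h)
  refine map_connectedSubgroup_le hf (k := nMinusAlg gr) (fun x hx => ?_)
    (Subgroup.mem_map_of_mem _ hn)
  rw [hS.deriv_one]
  exact hle hx

/-- Vectors invariant under `Ñ₊` do not see `Ñ₋` on the other side of a `Σ`-unitary form. -/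
theorem IsSigmaUnitary.apply_NMinus
    {σ : GroupLieAlgebra 𝓘(ℂ, E) G →ₛₗ[starRingEnd ℂ] GroupLieAlgebra 𝓘(ℂ, E) G}
    (hσ : IsGradedConjugation gr σ) {S : G ≃* G} (hS : IsAntiholomorphicExtension σ S)
    {V : Type*} [AddCommGroup V] [Module ℂ V] {B : V →ₗ⋆[ℂ] V →ₗ[ℂ] ℂ}
    {ρ : Representation ℂ G V} (hρ : IsSigmaUnitary S B ρ) {n : G} (hn : n ∈ NMinus gr)
    {u : V} (hu : u ∈ VPlus gr ρ) (w : V) : B u (ρ n w) = B u w := by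
  have hstar : ρ (hermConj S n) u = u := hu _ (hσ.map_NMinus hS (inv_mem hn))
  -- Hermitian symmetry brings `ρ n w` into the first argument, where `adjoint` applies; this avoids
  -- needing that `⋆` is an involution.
  rw [← hρ.hermitian, hρ.adjoint, hstar, hρ.hermitian]

variable [FiniteDimensional ℂ E]

/-- Bracketing with degree `0` preserves every degree. `P` is positivity or negativity in the
applications. -/
theorem IsGradation.lie_iSup_mem (hgr : IsGradation gr) (P : ℤ → Prop)
    (v : GroupLieAlgebra 𝓘(ℂ, E) G) (hv : v ∈ gr 0) (w : GroupLieAlgebra 𝓘(ℂ, E) G)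
    (hw : w ∈ ⨆ m : ℤ, ⨆ _ : P m, gr m) : ⁅v, w⁆ ∈ ⨆ m : ℤ, ⨆ _ : P m, gr m := by
  have hle : (⨆ m : ℤ, ⨆ _ : P m, gr m) ≤
      (⨆ m : ℤ, ⨆ _ : P m, gr m).comap
        (LieAlgebra.ad ℂ (GroupLieAlgebra 𝓘(ℂ, E) G) v) := by
    refine iSup₂_le fun m hm x hx => ?_
    have h := hgr.lie_mem 0 m v x hv hx
    rw [zero_add] at h
    exact Submodule.mem_iSup_of_mem m (Submodule.mem_iSup_of_mem hm h)
  exact hle hw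

theorem IsGradation.conj_mem_NPlus (hgr : IsGradation gr) {h n : G} (hh : h ∈ HZero gr)
    (hn : n ∈ NPlus gr) : h * n * h⁻¹ ∈ NPlus gr :=
  conj_mem_connectedSubgroup (hgr.lie_iSup_mem _) hh hn

theorem IsGradation.conj_mem_NMinus (hgr : IsGradation gr) {h n : G} (hh : h ∈ HZero gr)
    (hn : n ∈ NMinus gr) : h * n * h⁻¹ ∈ NMinus gr :=
  conj_mem_connectedSubgroup (hgr.lie_iSup_mem _) hh hn

variable {M : Type*} [TopologicalSpace M]

/-- The matrix elements of a Toda mapping between `Ñ₊`-invariant vectors. -/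
theorem IsTodaMapping.matrixElement_eq (hgr : IsGradation gr)
    {σ : GroupLieAlgebra 𝓘(ℂ, E) G →ₛₗ[starRingEnd ℂ] GroupLieAlgebra 𝓘(ℂ, E) G}
    (hσ : IsGradedConjugation gr σ) {S : G ≃* G} (hS : IsAntiholomorphicExtension σ S)
    {V : Type*} [AddCommGroup V] [Module ℂ V] {B : V →ₗ⋆[ℂ] V →ₗ[ℂ] ℂ}
    {ρ : Representation ℂ G V} (hρ : IsSigmaUnitary S B ρ) {φ : M → G} {D : LocalChoice G M}
    {γ : M → G} (hγ : IsTodaMapping gr φ D γ) {p : M} (hp : p ∈ D.W)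
    (hplus : D.gammaPlus p ∈ HZero gr) (hminus : D.gammaMinus p ∈ HZero gr)
    {u v : V} (hu : u ∈ VPlus gr ρ) (hv : v ∈ VPlus gr ρ) :
    matrixElement B ρ u γ v p = matrixElement B ρ u
      (fun p => (muPlus gr D.aPlus (piPlus gr ∘ φ) p * D.gammaPlus p)⁻¹ *
        (muMinus gr D.aMinus (piMinus gr ∘ φ) p * D.gammaMinus p)) v p := by
  obtain ⟨νMinus, ηMinus, νPlus, ηPlus, h⟩ := hγ
  obtain ⟨hνm, -, hνp, -, hφp, hφm, hγp⟩ := h p hp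
  have hn : (D.gammaPlus p)⁻¹ * νMinus p * ((D.gammaPlus p)⁻¹)⁻¹ ∈ NMinus gr :=
    hgr.conj_mem_NMinus (inv_mem hplus) hνm
  have hn' : (D.gammaMinus p)⁻¹ * (νPlus p)⁻¹ * ((D.gammaMinus p)⁻¹)⁻¹ ∈ NPlus gr :=
    hgr.conj_mem_NPlus (inv_mem hminus) (inv_mem hνp)
  have hdec : (muPlus gr D.aPlus (piPlus gr ∘ φ) p * D.gammaPlus p)⁻¹ *
      (muMinus gr D.aMinus (piMinus gr ∘ φ) p * D.gammaMinus p) =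
      ((D.gammaPlus p)⁻¹ * νMinus p * ((D.gammaPlus p)⁻¹)⁻¹) * γ p *
        ((D.gammaMinus p)⁻¹ * (νPlus p)⁻¹ * ((D.gammaMinus p)⁻¹)⁻¹) := by
    rw [hγp]
    exact inv_mul_eq_of_mul_eq (hφp.symm.trans hφm)
  have hsplit (a b c : G) (w : V) : ρ (a * b * c) w = ρ a (ρ b (ρ c w)) := by
    simp only [map_mul, Module.End.mul_apply]
  simp only [matrixElement]
  rw [hdec, hsplit, hv _ hn', hρ.apply_NMinus hσ hS hn hu]

end Grading

/-! ### Dependence of the choices on the projected mappings. -/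

section Choices

variable {E : Type*} [NormedAddCommGroup E] [NormedSpace ℂ E]
  {G : Type*} [TopologicalSpace G] [ChartedSpace E G] [Group G]
  {M : Type*} [TopologicalSpace M] [ChartedSpace ℂ M]
  {gr : ℤ → Submodule ℂ (GroupLieAlgebra 𝓘(ℂ, E) G)}

/-- The suitability of the choices depends on the mappings `φ±` on `W` only. -/
theorem LocalChoice.IsSuitable.congr {xPlus xMinus : GroupLieAlgebra 𝓘(ℂ, E) G}
    {φPlus ψPlus : M → FPlus gr} {φMinus ψMinus : M → FMinus gr} {D : LocalChoice G M}
    (hD : D.IsSuitable gr xPlus xMinus φPlus φMinus)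
    (hplus : ∀ p ∈ D.W, ψPlus p = φPlus p) (hminus : ∀ p ∈ D.W, ψMinus p = φMinus p) :
    D.IsSuitable gr xPlus xMinus ψPlus ψMinus where
  isOpen := hD.isOpen
  chart := hD.chart
  subset_source := hD.subset_source
  plus_mem p hp := by rw [hplus p hp]; exact hD.plus_mem p hp
  minus_mem p hp := by rw [hminus p hp]; exact hD.minus_mem p hp
  gammaPlus_mem := hD.gammaPlus_mem
  gammaMinus_mem := hD.gammaMinus_mem
  gammaPlus_anti := hD.gammaPlus_anti
  gammaMinus_holo := hD.gammaMinus_holo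
  lift_plus p hp := by
    rw [← hD.lift_plus p hp]
    -- The `dz̄`-component involves a derivative, so agreement near `p` is needed; openness of `W`
    -- supplies it.
    have h : muPlus gr D.aPlus ψPlus =ᶠ[𝓝 p] muPlus gr D.aPlus φPlus := by
      filter_upwards [hD.isOpen.mem_nhds hp] with q hq
      simp only [muPlus, hplus q hq]
    simp only [dzbarComponent, pullbackForm, realDeriv, h.mfderiv_eq, h.self_of_nhds]
  lift_minus p hp := by
    rw [← hD.lift_minus p hp]
    have h : muMinus gr D.aMinus ψMinus =ᶠ[𝓝 p] muMinus gr D.aMinus φMinus := by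
      filter_upwards [hD.isOpen.mem_nhds hp] with q hq
      simp only [muMinus, hminus q hq]
    simp only [dzComponent, pullbackForm, realDeriv, h.mfderiv_eq, h.self_of_nhds]

end Choices

end Toda

end

theorem theorem3p1
    {E : Type*} [NormedAddCommGroup E] [NormedSpace ℂ E] [FiniteDimensional ℂ E]
    {G : Type*} [TopologicalSpace G] [ChartedSpace E G] [Group G] [LieGroup 𝓘(ℂ, E) ω G]
    [LieAlgebra.IsSemisimple ℂ (GroupLieAlgebra 𝓘(ℂ, E) G)]
    {M : Type*} [TopologicalSpace M] [ChartedSpace ℂ M] [IsManifold 𝓘(ℂ, ℂ) ω M]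
    (gr : ℤ → Submodule ℂ (GroupLieAlgebra 𝓘(ℂ, E) G)) (hgr : Toda.IsGradation gr)
    (xPlus xMinus : GroupLieAlgebra 𝓘(ℂ, E) G)
    (hxPlus : xPlus ∈ gr 1) (hxPlus0 : xPlus ≠ 0)
    (hxMinus : xMinus ∈ gr (-1)) (hxMinus0 : xMinus ≠ 0)
    (σ : GroupLieAlgebra 𝓘(ℂ, E) G →ₛₗ[starRingEnd ℂ] GroupLieAlgebra 𝓘(ℂ, E) G)
    (hσ : Toda.IsGradedConjugation gr σ)
    (S : G ≃* G) (hS : Toda.IsAntiholomorphicExtension σ S)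
    {V : Type*} [AddCommGroup V] [Module ℂ V]
    (B : V →ₗ⋆[ℂ] V →ₗ[ℂ] ℂ) (ρ : Representation ℂ G V) (hρ : Toda.IsSigmaUnitary S B ρ)
    (φ : M → G) (hφ : Toda.IsAdmissible gr xPlus xMinus φ)
    (D : Toda.LocalChoice G M)
    (hD : D.IsSuitable gr xPlus xMinus (Toda.piPlus gr ∘ φ) (Toda.piMinus gr ∘ φ))
    (γ : M → G) (hγ : Toda.IsTodaMapping gr φ D γ)
    (u v : V) (hu : u ∈ Toda.VPlus gr ρ) (hv : v ∈ Toda.VPlus gr ρ) :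
    (∀ p ∈ D.W,
      Toda.matrixElement B ρ u γ v p =
        Toda.matrixElement B ρ u
          (fun p => (Toda.muPlus gr D.aPlus (Toda.piPlus gr ∘ φ) p * D.gammaPlus p)⁻¹ *
            (Toda.muMinus gr D.aMinus (Toda.piMinus gr ∘ φ) p * D.gammaMinus p)) v p) ∧
    (∀ φ' : M → G, Toda.IsAdmissible gr xPlus xMinus φ' →
      (∀ p ∈ D.W, Toda.piPlus gr (φ' p) = Toda.piPlus gr (φ p)) →
      (∀ p ∈ D.W, Toda.piMinus gr (φ' p) = Toda.piMinus gr (φ p)) →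
      D.IsSuitable gr xPlus xMinus (Toda.piPlus gr ∘ φ') (Toda.piMinus gr ∘ φ') ∧
      ∀ γ' : M → G, Toda.IsTodaMapping gr φ' D γ' →
        ∀ p ∈ D.W, Toda.matrixElement B ρ u γ' v p = Toda.matrixElement B ρ u γ v p) := by
  -- Stated for any mapping `ψ`, so as to apply to both `φ` and `φ'`; the memberships of `γ±` in
  -- `H̃` belong to the shared choices `D`.
  have main {ψ : M → G} {δ : M → G} (hδ : Toda.IsTodaMapping gr ψ D δ) {p : M} (hp : p ∈ D.W) :=
    hδ.matrixElement_eq hgr hσ hS hρ hp (hD.gammaPlus_mem p hp) (hD.gammaMinus_mem p hp) hu hv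
  refine ⟨fun p hp => main hγ hp, fun φ' _ hplus hminus =>
    ⟨hD.congr hplus hminus, fun γ' hγ' p hp => ?_⟩⟩
  rw [main hγ' hp, main hγ hp]
  simp only [Toda.matrixElement, Toda.muPlus, Toda.muMinus, Function.comp_apply, hplus p hp,
    hminus p hp]
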